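/- A family $\mathcal S=(S_1,\dots,S_m)$ of sets of edges is indexed, so members may repeat. An $\mathcal S$-rainbow matching is a matching that is the image of a partial choice function of $\mathcal S$, i.e. a matching of the form $\{x_i : i\in I\}$ with $I\subseteq\{1,\dots,m\}$ and $x_i\in S_i$ for all $i\in I$. Write $(m,k,n)\to_{\mathcal B} q$ for the statement: every $m$ nonempty sets of edges in a bipartite graph, the union of every $k$ of which contains a matching of size $n$, have a rainbow matching of size $q$. **Theorem.** Let $n\ge 0$ and $k>1$ be integers with $m=2n+k-3\ge 0$. 1. Let $\mathcal S=(S_1,\dots,S_m)$ be a family of $m=2n+k-3$ sets of edges in a bipartite graph, at most $k-2$ of which are empty. If for every $K\subseteq\{1,\dots,m\}$ of size $k$ the union $\bigcup_{i\in K}S_i$ contains a matching of size $n$, then $\mathcal S$ has a rainbow matching of size $n$. 2. In particular, $(2n+k-3,\,k,\,n)\to_{\mathcal B} n$. -/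

import Mathlib

universe u

namespace CoopRainbow

/-- A set of edges is a matching if no two distinct edges in it share a vertex.
(It is only applied to sets of edges of a simple graph, which contain no loops.) -/
def IsEdgeMatching {V : Type u} (M : Set (Sym2 V)) : Prop :=
  ∀ e ∈ M, ∀ f ∈ M, e ≠ f → ∀ v : V, ¬ (v ∈ e ∧ v ∈ f)

/-- `F` contains a matching of size `n`. -/
def HasMatching {V : Type u} (F : Set (Sym2 V)) (n : ℕ) : Prop :=
  ∃ M : Finset (Sym2 V), (M : Set (Sym2 V)) ⊆ F ∧ IsEdgeMatching (M : Set (Sym2 V)) ∧ M.card = n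

/-- `R` is a rainbow set of the family `S₁, …, Sₘ`: the image of a partial choice function, that
is, of a choice of an element `x i ∈ S i` for each `i` in some set `I` of indices. -/
def IsRainbowSet {α : Type u} {m : ℕ} (S : Fin m → Set α) (R : Set α) : Prop :=
  ∃ (I : Set (Fin m)) (x : I → α), (∀ i : I, x i ∈ S i) ∧ Set.range x = R

/-- The family `S` has a rainbow matching of size `n`. -/
def HasRainbowMatching {V : Type u} {m : ℕ} (S : Fin m → Set (Sym2 V)) (n : ℕ) : Prop :=
  ∃ M : Finset (Sym2 V), IsRainbowSet S (M : Set (Sym2 V)) ∧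
    IsEdgeMatching (M : Set (Sym2 V)) ∧ M.card = n

/-- The union of every `k` members of the family (members are counted with multiplicity)
contains a matching of size `n`. -/
def UnionsHaveMatching {V : Type u} {m : ℕ} (S : Fin m → Set (Sym2 V)) (k n : ℕ) : Prop :=
  ∀ K : Finset (Fin m), K.card = k → HasMatching (⋃ i ∈ K, S i) n

/-- `(m, k, n) →_B q`: every `m` nonempty sets of edges in a bipartite graph, the union of every
`k` of which contains a matching of size `n`, have a rainbow matching of size `q`. -/
def ArrowB (m k n q : ℕ) : Prop :=
  ∀ (V : Type u) (G : SimpleGraph V), G.IsBipartite →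
    ∀ S : Fin m → Set (Sym2 V), (∀ i, S i ⊆ G.edgeSet) → (∀ i, (S i).Nonempty) →
      UnionsHaveMatching S k n → HasRainbowMatching S q

end CoopRainbow

/-! Take a largest rainbow matching, with left vertex set `X` and `p < n` edges, and grow an
alternating tree `R ⊆ X` by replacing edges with edges of unused indices. When the tree is maximal,
`R` and `φ (X \ R)` together are `p` vertices covering every unused index outside `J`, so fewer than
`k` such indices remain. Since `|J| ≤ |R| ≤ p ≤ n - 1`, the value of `m` forces `R = X`, and at
least `k - 1` unused indices have all their edges at `X` (`exists_indices_without_outer_edges`). One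
of these, `ν`, is nonempty. By `exists_exchange` some rainbow matching on the same `X` uses `ν`. It
too leaves `k - 1` unused indices with all edges at `X`; together with `ν` these are `k` indices
covered by `p < n` vertices, a contradiction. -/

namespace CoopRainbow

section Abstract

variable {ι : Type*} {A B : Type*}

/-- The edges `(a, φ a)` for `a ∈ X` form a matching, rainbow via the injective colouring `c`. -/
structure IsRainbowOn (E : ι → A → B → Prop) (X : Finset A) (φ : A → B) (c : A → ι) : Prop where
  injOn : Set.InjOn φ X
  injOn_index : Set.InjOn c X
  edge : ∀ a ∈ X, E (c a) a (φ a)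

/-- No `X` of vertices on the left and `Y` on the right with fewer than `n` elements altogether
cover all edges of `k` members of the family. -/
def NoSmallCover (E : ι → A → B → Prop) (k n : ℕ) : Prop :=
  ∀ (K : Finset ι) (X : Finset A) (Y : Finset B), k ≤ K.card → X.card + Y.card < n →
    ∃ i ∈ K, ∃ a b, E i a b ∧ a ∉ X ∧ b ∉ Y

theorem injOn_update_insert [DecidableEq A] {γ : Type*} {f : A → γ} {X : Finset A} (a : A) {y : γ}
    (hf : Set.InjOn f X) (hy : ∀ x ∈ X, f x ≠ y) :
    Set.InjOn (Function.update f a y) (insert a X : Finset A) := by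
  intro x hx x' hx' hxx
  simp only [Finset.coe_insert, Set.mem_insert_iff, Finset.mem_coe] at hx hx'
  by_cases h1 : x = a <;> by_cases h2 : x' = a
  · rw [h1, h2]
  · rw [h1, Function.update_self, Function.update_of_ne h2] at hxx
    exact absurd hxx.symm (hy x' (hx'.resolve_left h2))
  · rw [h2, Function.update_self, Function.update_of_ne h1] at hxx
    exact absurd hxx (hy x (hx.resolve_left h1))
  · rw [Function.update_of_ne h1, Function.update_of_ne h2] at hxx
    exact hf (hx.resolve_left h1) (hx'.resolve_left h2) hxx

/-- Serves both uses of a new edge: it replaces the edge at `a` if `a ∈ X`, and enlarges the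
matching otherwise. -/
theorem IsRainbowOn.update [DecidableEq A] {E : ι → A → B → Prop} {X : Finset A} {φ : A → B}
    {c : A → ι} (h : IsRainbowOn E X φ c) {a : A} {b : B} {i : ι} (hE : E i a b)
    (hb : ∀ x ∈ X, φ x ≠ b) (hi : ∀ x ∈ X, c x ≠ i) :
    IsRainbowOn E (insert a X) (Function.update φ a b) (Function.update c a i) := by
  refine ⟨injOn_update_insert a h.injOn hb, injOn_update_insert a h.injOn_index hi, fun x hx => ?_⟩
  by_cases h1 : x = a
  · subst h1; simpa using hE
  · rw [Function.update_of_ne h1, Function.update_of_ne h1]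
    exact h.edge x ((Finset.mem_insert.1 hx).resolve_left h1)

/-! ### Alternating trees -/

/-- The right vertex `b` can be missed by a rainbow matching with the same left vertices `X`, that
differs from `φ` only on `R` and uses, besides the indices of `c`, only indices in `J`. -/
def Freeable (E : ι → A → B → Prop) (X : Finset A) (φ : A → B) (c : A → ι) (R : Finset A)
    (J : Finset ι) (b : B) : Prop :=
  ∃ φ' c', IsRainbowOn E X φ' c' ∧ (∀ x ∈ X, φ' x ≠ b) ∧ (∀ x ∈ X, x ∉ R → φ' x = φ x) ∧
    ∀ i ∉ J, (∀ x ∈ X, c x ≠ i) → ∀ x ∈ X, c' x ≠ i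

/-- An alternating tree: `R` is a set of reached left vertices and `J ⊆ T` is the set of indices
used for reaching them. -/
structure IsAltTree (E : ι → A → B → Prop) (X : Finset A) (φ : A → B) (c : A → ι)
    (T : Finset ι) (R : Finset A) (J : Finset ι) : Prop where
  subset : R ⊆ X
  subset_index : J ⊆ T
  card_le : J.card ≤ R.card
  freeable : ∀ b, (∀ x ∈ X, x ∉ R → φ x ≠ b) → Freeable E X φ c R J b

/-- Once `b` is freed, the edge `(a, b)` of index `i` can replace the edge at `a`, which frees `φ
a`. -/
theorem IsAltTree.insert [DecidableEq A] [DecidableEq ι] {E : ι → A → B → Prop} {X : Finset A}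
    {φ : A → B} {c : A → ι} {T : Finset ι} {R : Finset A} {J : Finset ι}
    (h : IsAltTree E X φ c T R J) (hT : ∀ x ∈ X, c x ∉ T) {i : ι} {a : A}
    {b : B} (hi : i ∈ T) (hiJ : i ∉ J) (hE : E i a b) (ha : a ∈ X) (haR : a ∉ R)
    (hb : ∀ x ∈ X, x ∉ R → φ x ≠ b) :
    IsAltTree E X φ c T (insert a R) (insert i J) := by
  refine ⟨Finset.insert_subset ha h.subset, Finset.insert_subset hi h.subset_index, ?_, ?_⟩
  · rw [Finset.card_insert_of_notMem hiJ, Finset.card_insert_of_notMem haR]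
    exact Nat.succ_le_succ h.card_le
  intro b' hb'
  by_cases hab : φ a = b'
  · obtain ⟨φ', c', h1, h2, h3, h4⟩ := h.freeable b hb
    have hic := h4 i hiJ fun x hx hxi => hT x hx (hxi ▸ hi)
    have h5 := h1.update hE h2 hic
    rw [Finset.insert_eq_of_mem ha] at h5
    refine ⟨_, _, h5, fun x hx => ?_, fun x hx hxR => ?_,
      fun j hj hcj x hx => ?_⟩
    · by_cases hxa : x = a
      · subst hxa
        rw [Function.update_self, ← hab]
        exact (hb x ha haR).symm
      -- As `a ∉ R`, freeing `b` left the edge at `a` alone, so injectivity of `φ'` keeps other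
      -- edges off `φ a`.
      · rw [Function.update_of_ne hxa, ← hab, ← h3 a ha haR]
        exact fun h6 => hxa (h1.injOn hx ha h6)
    · rw [Finset.mem_insert, not_or] at hxR
      rw [Function.update_of_ne hxR.1]
      exact h3 x hx hxR.2
    · by_cases hxa : x = a
      · subst hxa
        rw [Function.update_self]
        exact fun h => hj (h ▸ Finset.mem_insert_self i J)
      · rw [Function.update_of_ne hxa]
        exact h4 j (fun h => hj (Finset.mem_insert_of_mem h)) hcj x hx
  · have hb2 : ∀ x ∈ X, x ∉ R → φ x ≠ b' := by
      intro x hx hxR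
      by_cases hxa : x = a
      · rwa [hxa]
      · exact hb' x hx (by simp [hxa, hxR])
    obtain ⟨φ', c', h1, h2, h3, h4⟩ := h.freeable b' hb2
    exact ⟨φ', c', h1, h2, fun x hx hxR => h3 x hx fun h => hxR (Finset.mem_insert_of_mem h),
      fun j hj => h4 j fun h => hj (Finset.mem_insert_of_mem h)⟩

/-- A maximal alternating tree, for a rainbow matching that cannot be enlarged. -/
theorem exists_maximal_altTree {E : ι → A → B → Prop} {X : Finset A} {φ : A → B} {c : A → ι}
    (hM : IsRainbowOn E X φ c)
    (hmax : ∀ (X' : Finset A) φ' c', IsRainbowOn E X' φ' c' → X'.card ≤ X.card)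
    (T : Finset ι) (hT : ∀ x ∈ X, c x ∉ T) :
    ∃ R J, IsAltTree E X φ c T R J ∧ ∀ i ∈ T, i ∉ J → ∀ a b, E i a b → a ∉ R →
      ∃ x ∈ X, x ∉ R ∧ φ x = b := by
  classical
  have key : ∀ (d : ℕ) (R : Finset A) (J : Finset ι), IsAltTree E X φ c T R J →
      X.card = R.card + d → ∃ R J, IsAltTree E X φ c T R J ∧ ∀ i ∈ T, i ∉ J → ∀ a b, E i a b →
        a ∉ R → ∃ x ∈ X, x ∉ R ∧ φ x = b := by
    intro d
    induction d with
    | zero =>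
      intro R J h hd
      by_contra! hcon
      obtain ⟨i, hi, hiJ, a, b, hE, haR, hb⟩ := hcon R J h
      have hRX : R = X := Finset.eq_of_subset_of_card_le h.subset (by omega)
      obtain ⟨φ', c', h1, h2, h3, h4⟩ := h.freeable b hb
      have hic := h4 i hiJ fun x hx hxi => hT x hx (hxi ▸ hi)
      have := hmax _ _ _ (h1.update hE h2 hic)
      rw [Finset.card_insert_of_notMem (hRX ▸ haR)] at this
      omega
    | succ d ih =>
      intro R J h hd
      by_contra! hcon
      obtain ⟨i, hi, hiJ, a, b, hE, haR, hb⟩ := hcon R J h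
      by_cases ha : a ∈ X
      · obtain ⟨R', J', h', h''⟩ := ih _ _ (h.insert hT hi hiJ hE ha haR hb)
          (by rw [Finset.card_insert_of_notMem haR]; omega)
        obtain ⟨i', hi', hiJ', a', b', hE', haR', hb'⟩ := hcon R' J' h'
        obtain ⟨x, hx, hxR, hxb⟩ := h'' i' hi' hiJ' a' b' hE' haR'
        exact hb' x hx hxR hxb
      · obtain ⟨φ', c', h1, h2, h3, h4⟩ := h.freeable b hb
        have hic := h4 i hiJ fun x hx hxi => hT x hx (hxi ▸ hi)
        have := hmax _ _ _ (h1.update hE h2 hic)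
        rw [Finset.card_insert_of_notMem ha] at this
        omega
  refine key X.card ∅ ∅ ⟨by simp, by simp, by simp, fun b hb => ?_⟩ (by simp)
  exact ⟨φ, c, hM, fun x hx => hb x hx (by simp), fun _ _ _ => rfl, fun _ _ h => h⟩

/-- Outside an alternating tree, `k` indices always leave an edge that the tree can use. -/
theorem IsAltTree.exists_edge {E : ι → A → B → Prop} {k n : ℕ} (hcov : NoSmallCover E k n)
    {X : Finset A} {φ : A → B} {c : A → ι} {T : Finset ι} {R : Finset A} {J : Finset ι}
    (h : IsAltTree E X φ c T R J) (hX : X.card < n) (K : Finset ι) (hK : k ≤ K.card) :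
    ∃ i ∈ K, ∃ a b, E i a b ∧ a ∉ R ∧ ∀ x ∈ X, x ∉ R → φ x ≠ b := by
  classical
  obtain ⟨i, hi, a, b, hE, ha, hb⟩ := hcov K R ((X \ R).image φ) hK (by
    have h1 := Finset.card_image_le (s := X \ R) (f := φ)
    have h2 := Finset.card_sdiff_add_card_eq_card h.subset
    omega)
  refine ⟨i, hi, a, b, hE, ha, fun x hx hxR hxb => hb ?_⟩
  exact Finset.mem_image.2 ⟨x, Finset.mem_sdiff.2 ⟨hx, hxR⟩, hxb⟩

/-! ### Counting unused indices -/

variable [Fintype ι]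

/-- If a rainbow matching of size less than `n` cannot be enlarged, then at least `k - 1` indices
unused by it have all their edges at the left vertices of the matching. -/
theorem exists_indices_without_outer_edges {E : ι → A → B → Prop} {k n : ℕ}
    (hcov : NoSmallCover E k n) (hm : 2 * n + k ≤ Fintype.card ι + 3)
    {X : Finset A} {φ : A → B} {c : A → ι} (hM : IsRainbowOn E X φ c) (hX : X.card < n)
    (hmax : ∀ (X' : Finset A) φ' c', IsRainbowOn E X' φ' c' → X'.card ≤ X.card) :
    ∃ N : Finset ι, k ≤ N.card + 1 ∧
      (∀ x ∈ X, c x ∉ N) ∧ ∀ i ∈ N, ∀ a b, E i a b → a ∈ X := by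
  classical
  obtain ⟨R, J, h, hmaxR⟩ := exists_maximal_altTree hM hmax (X.image c)ᶜ
    (fun x hx => by simpa using ⟨x, hx, rfl⟩)
  have hT : (X.image c)ᶜ.card + X.card = Fintype.card ι := by
    rw [← Finset.card_image_of_injOn hM.injOn_index, Finset.card_compl_add_card]
  have hJ := Finset.card_sdiff_add_card_eq_card h.subset_index
  have hRX := Finset.card_le_card h.subset
  have hlt : ((X.image c)ᶜ \ J).card < k := by
    by_contra! hk
    obtain ⟨i, hi, a, b, hE, ha, hb⟩ := h.exists_edge hcov hX _ hk
    obtain ⟨hi, hiJ⟩ := Finset.mem_sdiff.1 hi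
    obtain ⟨x, hx, hxR, hxb⟩ := hmaxR i hi hiJ a b hE ha
    exact hb x hx hxR hxb
  have hcard := h.card_le
  refine ⟨(X.image c)ᶜ \ J, by omega, fun x hx hxN => ?_, fun i hi a b hE => ?_⟩
  · exact Finset.mem_compl.1 (Finset.mem_sdiff.1 hxN).1 (Finset.mem_image_of_mem c hx)
  -- Here `|J| ≥ (m - p) - (k - 1) = 2n - 2 - p ≥ p` with `p = |X|`, while `|J| ≤ |R| ≤ p`.
  · have hR : R = X := Finset.eq_of_subset_of_card_le h.subset (by omega)
    by_contra ha
    obtain ⟨hi, hiJ⟩ := Finset.mem_sdiff.1 hi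
    obtain ⟨x, hx, hxR, -⟩ := hmaxR i hi hiJ a b hE (hR ▸ ha)
    exact hxR (hR ▸ hx)

/-- An index `ν` with at least one edge, all of whose edges are at the left vertices of a maximal
rainbow matching, occurs in a rainbow matching with the same left vertices. -/
theorem exists_exchange {E : ι → A → B → Prop} {k n : ℕ}
    (hcov : NoSmallCover E k n) (hm : 2 * n + k ≤ Fintype.card ι + 3)
    {X : Finset A} {φ : A → B} {c : A → ι} (hM : IsRainbowOn E X φ c) (hX : X.card < n)
    (hmax : ∀ (X' : Finset A) φ' c', IsRainbowOn E X' φ' c' → X'.card ≤ X.card)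
    {ν : ι} (hν : ∀ x ∈ X, c x ≠ ν) (hνX : ∀ a b, E ν a b → a ∈ X) (hne : ∃ a b, E ν a b) :
    ∃ φ' c', IsRainbowOn E X φ' c' ∧ ∃ x ∈ X, c' x = ν := by
  classical
  have hνT : ν ∈ (X.image c)ᶜ := by simpa using hν
  obtain ⟨R, J, h, hmaxR⟩ := exists_maximal_altTree hM hmax ((X.image c)ᶜ.erase ν)
    (fun x hx hxT => by simp only [Finset.mem_erase, Finset.mem_compl] at hxT
                        exact hxT.2 (Finset.mem_image_of_mem c hx))
  have hνJ : ν ∉ J := fun hJ => Finset.notMem_erase ν _ (h.subset_index hJ)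
  have hex : ∃ a b, E ν a b ∧ ∀ x ∈ X, x ∉ R → φ x ≠ b := by
    by_cases hR : R = X
    · obtain ⟨a, b, hE⟩ := hne
      exact ⟨a, b, hE, fun x hx hxR => absurd (hR ▸ hx) hxR⟩
    have hlt : R.card < X.card :=
      Finset.card_lt_card (h.subset.ssubset_of_ne hR)
    have hT : (X.image c)ᶜ.card + X.card = Fintype.card ι := by
      rw [← Finset.card_image_of_injOn hM.injOn_index, Finset.card_compl_add_card]
    have hJ := Finset.card_sdiff_add_card_eq_card
      (h.subset_index.trans (Finset.erase_subset ν _))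
    have hcard := h.card_le
    -- Now `|J| ≤ p - 1`, so at least `m - 2p + 1 ≥ k` indices remain, `ν` among them. By maximality
    -- of the tree only `ν` can supply the edge.
    obtain ⟨i, hi, a, b, hE, ha, hb⟩ := h.exists_edge hcov hX ((X.image c)ᶜ \ J) (by omega)
    obtain ⟨hi, hiJ⟩ := Finset.mem_sdiff.1 hi
    by_cases hiν : i = ν
    · exact ⟨a, b, hiν ▸ hE, hb⟩
    · obtain ⟨x, hx, hxR, hxb⟩ := hmaxR i (Finset.mem_erase.2 ⟨hiν, hi⟩) hiJ a b hE ha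
      exact absurd hxb (hb x hx hxR)
  obtain ⟨a, b, hE, hb⟩ := hex
  obtain ⟨φ', c', h1, h2, -, h4⟩ := h.freeable b hb
  have h5 := h1.update hE h2 (h4 ν hνJ hν)
  have ha := hνX a b hE
  rw [Finset.insert_eq_of_mem ha] at h5
  exact ⟨_, _, h5, a, ha, Function.update_self ..⟩

theorem exists_isRainbowOn_card_eq {E : ι → A → B → Prop} {k n : ℕ}
    (hcov : NoSmallCover E k n) (hm : 2 * n + k ≤ Fintype.card ι + 3)
    (hempty : {i | ∀ a b, ¬ E i a b}.ncard + 1 < k) (φ₀ : A → B) (c₀ : A → ι) :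
    ∃ X φ c, IsRainbowOn E X φ c ∧ X.card = n := by
  classical
  by_contra! hcon
  have hlt : ∀ X φ c, IsRainbowOn E X φ c → X.card < n := by
    intro X φ c h
    by_contra! hX
    obtain ⟨Y, hYX, hY⟩ := Finset.exists_subset_card_eq hX
    exact hcon Y φ c ⟨h.injOn.mono (by exact_mod_cast hYX),
      h.injOn_index.mono (by exact_mod_cast hYX), fun a ha => h.edge a (hYX ha)⟩ hY
  obtain ⟨p, ⟨X, φ, c, hM, rfl⟩, hp⟩ : ∃ p, (∃ X φ c, IsRainbowOn E X φ c ∧ X.card = p) ∧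
      ∀ q, (∃ X φ c, IsRainbowOn E X φ c ∧ X.card = q) → q ≤ p := by
    have hb : BddAbove {p | ∃ X φ c, IsRainbowOn E X φ c ∧ X.card = p} :=
      ⟨n, by rintro _ ⟨X, φ, c, h, rfl⟩; exact (hlt X φ c h).le⟩
    -- The total functions `φ₀` and `c₀` are only needed to represent the empty matching.
    have h0 : IsRainbowOn E ∅ φ₀ c₀ := ⟨by simp, by simp, by simp⟩
    have hne : {p | ∃ X φ c, IsRainbowOn E X φ c ∧ X.card = p}.Nonempty := ⟨0, ∅, φ₀, c₀, h0, rfl⟩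
    exact ⟨_, Nat.sSup_mem hne hb, fun q hq => le_csSup hb hq⟩
  have hmax : ∀ (X' : Finset A) φ' c', IsRainbowOn E X' φ' c' → X'.card ≤ X.card :=
    fun X' φ' c' h => hp _ ⟨X', φ', c', h, rfl⟩
  have hX := hlt X φ c hM
  obtain ⟨N, hN, hNc, hNX⟩ := exists_indices_without_outer_edges hcov hm hM hX hmax
  obtain ⟨ν, hνN, hne⟩ : ∃ ν ∈ N, ∃ a b, E ν a b := by
    by_contra! hall
    have : N.card ≤ {i | ∀ a b, ¬ E i a b}.ncard := by
      rw [← Set.ncard_coe_finset]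
      exact Set.ncard_le_ncard (fun i hi => hall i hi) (Set.toFinite _)
    omega
  obtain ⟨φ', c', hM', x, hx, hxν⟩ := exists_exchange hcov hm hM hX hmax
    (fun x hx hxν => hNc x hx (hxν ▸ hνN)) (hNX ν hνN) hne
  obtain ⟨N', hN', hNc', hNX'⟩ := exists_indices_without_outer_edges hcov hm hM' hX hmax
  have hνN' : ν ∉ N' := hxν ▸ hNc' x hx
  obtain ⟨i, hi, a, b, hE, ha, -⟩ := hcov (insert ν N') X ∅
    (by rw [Finset.card_insert_of_notMem hνN']; omega) (by simpa using hX)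
  rcases Finset.mem_insert.1 hi with rfl | hi
  · exact ha (hNX i hνN a b hE)
  · exact ha (hNX' i hi a b hE)

end Abstract

/-! ### Translation to bipartite graphs -/

/-- Fewer than `n` vertices do not cover a set of edges that contains a matching of size `n`. -/
theorem HasMatching.exists_edge_avoiding {V : Type u} {F : Set (Sym2 V)} {n : ℕ}
    (h : HasMatching F n) (Z : Finset V) (hZ : Z.card < n) : ∃ e ∈ F, ∀ v ∈ e, v ∉ Z := by
  obtain ⟨M, hMF, hM, rfl⟩ := h
  by_contra! hcon
  -- `choose!` needs a default vertex.
  have : Nonempty V := by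
    obtain ⟨e, he⟩ := Finset.card_pos.1 (Nat.zero_lt_of_lt hZ)
    exact ⟨(hcon e (hMF he)).choose⟩
  choose! f hfe hfZ using fun e (he : e ∈ M) => hcon e (hMF he)
  obtain ⟨e, he, e', he', hne, heq⟩ := Finset.exists_ne_map_eq_of_card_lt_of_maps_to hZ hfZ
  exact hM e he e' he' hne (f e) ⟨hfe e he, heq ▸ hfe e' he'⟩

theorem hasRainbowMatching_of_unionsHaveMatching {V : Type u} {G : SimpleGraph V}
    (hG : G.IsBipartite) {n k m : ℕ} (hk : 1 < k) (hm : m + 3 = 2 * n + k)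
    (S : Fin m → Set (Sym2 V)) (hS : ∀ i, S i ⊆ G.edgeSet)
    (hempty : {i : Fin m | S i = ∅}.ncard ≤ k - 2) (hU : UnionsHaveMatching S k n) :
    HasRainbowMatching S n := by
  classical
  rcases Nat.eq_zero_or_pos n with rfl | hn
  · exact ⟨∅, ⟨∅, fun i => i.2.elim, fun i => i.2.elim, by simp⟩, by simp [IsEdgeMatching], rfl⟩
  have hm0 : 0 < m := by omega
  obtain ⟨C⟩ : Nonempty (G.Coloring (Fin 2)) := hG
  let E : Fin m → V → V → Prop := fun i a b => s(a, b) ∈ S i ∧ C a = 0 ∧ C b = 1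
  have horient : ∀ i, ∀ e ∈ S i, ∃ a b, e = s(a, b) ∧ E i a b := by
    intro i e he
    induction e with
    | _ a b =>
      have hne : C a ≠ C b := C.valid (hS i he)
      have : (C a = 0 ∧ C b = 1) ∨ (C b = 0 ∧ C a = 1) := by omega
      rcases this with h | h
      · exact ⟨a, b, rfl, he, h⟩
      · exact ⟨b, a, Sym2.eq_swap, by rwa [Sym2.eq_swap], h⟩
  have hcov : NoSmallCover E k n := by
    intro K X Y hK hXY
    obtain ⟨K', hK'K, hK'⟩ := Finset.exists_subset_card_eq hK
    obtain ⟨e, he, heZ⟩ := (hU K' hK').exists_edge_avoiding (X ∪ Y)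
      ((Finset.card_union_le X Y).trans_lt hXY)
    obtain ⟨i, hi, he⟩ := Set.mem_iUnion₂.1 he
    obtain ⟨a, b, rfl, hE⟩ := horient i e he
    exact ⟨i, hK'K hi, a, b, hE, fun h => heZ a (by simp) (Finset.mem_union_left _ h),
      fun h => heZ b (by simp) (Finset.mem_union_right _ h)⟩
  have hempty' : {i | ∀ a b, ¬ E i a b}.ncard + 1 < k := by
    have : {i | ∀ a b, ¬ E i a b}.ncard ≤ {i : Fin m | S i = ∅}.ncard := by
      refine Set.ncard_le_ncard (fun i hi => ?_) (Set.toFinite _)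
      refine Set.eq_empty_of_forall_notMem fun e he => ?_
      obtain ⟨a, b, -, hE⟩ := horient i e he
      exact hi a b hE
    omega
  obtain ⟨X, φ, c, hM, rfl⟩ := exists_isRainbowOn_card_eq hcov (by simp; omega) hempty' id
    (fun _ => ⟨0, hm0⟩)
  have hinj : ∀ x ∈ X, ∀ y ∈ X, ∀ v, v ∈ s(x, φ x) → v ∈ s(y, φ y) → x = y := by
    intro x hx y hy v hvx hvy
    obtain ⟨-, hx0, hx1⟩ := hM.edge x hx
    obtain ⟨-, hy0, hy1⟩ := hM.edge y hy
    rw [Sym2.mem_iff] at hvx hvy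
    rcases hvx with rfl | rfl <;> rcases hvy with h | h
    · exact h
    · rw [← h, hx0] at hy1; exact absurd hy1 (by decide)
    · rw [← h, hx1] at hy0; exact absurd hy0 (by decide)
    · exact hM.injOn hx hy h
  refine ⟨X.image fun x => s(x, φ x), ⟨c '' X, fun i => s(i.2.choose, φ i.2.choose), ?_, ?_⟩,
    ?_, ?_⟩
  · rintro ⟨i, hi⟩
    have h := (hM.edge _ hi.choose_spec.1).1
    rwa [hi.choose_spec.2] at h
  · ext e
    simp only [Set.mem_range, Finset.coe_image, Set.mem_image, Finset.mem_coe]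
    constructor
    · rintro ⟨i, rfl⟩
      exact ⟨_, i.2.choose_spec.1, rfl⟩
    · rintro ⟨x, hx, rfl⟩
      have hi : c x ∈ c '' X := ⟨x, hx, rfl⟩
      refine ⟨⟨c x, hi⟩, ?_⟩
      have h : hi.choose = x := hM.injOn_index hi.choose_spec.1 hx hi.choose_spec.2
      simp only [h]
  · intro e he f hf hef v hv
    obtain ⟨x, hx, rfl⟩ := Finset.mem_image.1 (Finset.mem_coe.1 he)
    obtain ⟨y, hy, rfl⟩ := Finset.mem_image.1 (Finset.mem_coe.1 hf)
    exact hef (by rw [hinj x hx y hy v hv.1 hv.2])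
  · refine Finset.card_image_of_injOn fun x hx y hy hxy => ?_
    exact hinj x hx y hy x (by simp)
      ((show s(x, φ x) = s(y, φ y) from hxy) ▸ Sym2.mem_mk_left x (φ x))

end CoopRainbow

theorem mainTheorem1 (n k m : ℕ) (hk : 1 < k) (hm : m + 3 = 2 * n + k) :
    (∀ (V : Type u) (G : SimpleGraph V), G.IsBipartite →
      ∀ S : Fin m → Set (Sym2 V), (∀ i, S i ⊆ G.edgeSet) →
        {i : Fin m | S i = ∅}.ncard ≤ k - 2 →
        CoopRainbow.UnionsHaveMatching S k n → CoopRainbow.HasRainbowMatching S n) ∧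
    CoopRainbow.ArrowB.{u} m k n n := by
  refine ⟨fun V G hG S hS hempty hU =>
    CoopRainbow.hasRainbowMatching_of_unionsHaveMatching hG hk hm S hS hempty hU,
    fun V G hG S hS hne hU =>
    CoopRainbow.hasRainbowMatching_of_unionsHaveMatching hG hk hm S hS ?_ hU⟩
  have : {i : Fin m | S i = ∅} = ∅ :=
    Set.eq_empty_of_forall_notMem fun i hi => (hne i).ne_empty hi
  simp [this]
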